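/- Let $k$ be a field of characteristic zero. A unital generalized Poisson algebra over $k$ is a vector space $A$ with a commutative associative bilinear product $\cdot$ with unit $1$ and an anticommutative bilinear bracket $\{\,,\}$ such that, with $D(a)=\{a,1\}$, for all $a,b,c\in A$ $$\{a,bc\}=\{a,b\}c+b\{a,c\}-D(a)bc,\qquad \{a,\{b,c\}\}=\{\{a,b\},c\}+\{b,\{a,c\}\}.$$ For $n\ge 0$ let $GenP$ be the free unital generalized Poisson algebra on the generators $1,x_1,\dots,x_n$: the quotient of the free non-associative $k$-algebra with two multiplications on the alphabet $\{1,x_1,\dots,x_n\}$ by the ideal generated by these identities (the letter $1$ becoming the unit). A bracket word is a word formed from the letters $1,x_1,\dots,x_n$ using the bracket alone. Let $GenP(n)$ be the multihomogeneous component of $GenP$ of degree one in each of $1,x_1,\dots,x_n$, that is, the subspace of $GenP$ spanned by all products $u_1u_2\cdots u_r$ ($r\ge 1$), where each $u_i$ is a bracket word different from the one-letter word $1$ and each of the letters $1,x_1,\dots,x_n$ occurs exactly once in $u_1,\dots,u_r$ altogether. Then $$\dim_k GenP(n)=n\cdot n!.$$ -/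

import Mathlib

open scoped Nat

/-- Non-associative words in the alphabet `X` for two binary operations: the product `dot`
and the bracket `brk`. They form the standard basis of the free dialgebra on `X`. -/
inductive DiWord (X : Type) : Type
  | gen : X → DiWord X
  | dot : DiWord X → DiWord X → DiWord X
  | brk : DiWord X → DiWord X → DiWord X

namespace DiWord

/-- The number of occurrences of the letter `x` in a word. -/
def count {X : Type} [DecidableEq X] (x : X) : DiWord X → ℕ
  | gen y => if y = x then 1 else 0
  | dot u v => count x u + count x v
  | brk u v => count x u + count x v

/-- Bracket words: words formed from letters using the bracket alone. -/
inductive IsLie {X : Type} : DiWord X → Prop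
  | gen (x : X) : IsLie (gen x)
  | brk {u v : DiWord X} (hu : IsLie u) (hv : IsLie v) : IsLie (brk u v)

/-- Products (with any arrangement of parentheses) of one or more bracket words, none of which
is the single letter `e`. -/
inductive IsLieProduct {X : Type} (e : X) : DiWord X → Prop
  | lie {u : DiWord X} (hu : IsLie u) (hne : u ≠ gen e) : IsLieProduct e u
  | dot {u v : DiWord X} (hu : IsLieProduct e u) (hv : IsLieProduct e v) :
      IsLieProduct e (dot u v)

end DiWord

/-- The free non-associative algebra with two multiplications over `k` on the set `X`. -/
abbrev FreeDialgebra (k : Type*) [Field k] (X : Type) : Type _ := DiWord X →₀ k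

namespace FreeDialgebra

noncomputable section

variable {k : Type*} [Field k] {X : Type}

/-- The product: the bilinear extension of `DiWord.dot`. -/
def dot : FreeDialgebra k X →ₗ[k] FreeDialgebra k X →ₗ[k] FreeDialgebra k X :=
  Finsupp.linearCombination k fun u => Finsupp.lmapDomain k k (DiWord.dot u)

/-- The bracket: the bilinear extension of `DiWord.brk`. -/
def brk : FreeDialgebra k X →ₗ[k] FreeDialgebra k X →ₗ[k] FreeDialgebra k X :=
  Finsupp.linearCombination k fun u => Finsupp.lmapDomain k k (DiWord.brk u)

/-- A word, as an element of the free dialgebra. -/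
def ofWord (w : DiWord X) : FreeDialgebra k X := Finsupp.single w 1

/-- A two-sided ideal for both multiplications. -/
def IsIdeal (J : Submodule k (FreeDialgebra k X)) : Prop :=
  ∀ a : FreeDialgebra k X, ∀ z ∈ J, dot a z ∈ J ∧ dot z a ∈ J ∧ brk a z ∈ J ∧ brk z a ∈ J

/-- The defining relators of unital generalized Poisson algebras, where the letter `e` becomes
the unit and `D a = {a, 1}`. -/
inductive IsRelator (e : X) : FreeDialgebra k X → Prop
  | dot_comm (a b : FreeDialgebra k X) : IsRelator e (dot a b - dot b a)
  | dot_assoc (a b c : FreeDialgebra k X) : IsRelator e (dot (dot a b) c - dot a (dot b c))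
  | one_dot (a : FreeDialgebra k X) : IsRelator e (dot (ofWord (.gen e)) a - a)
  | brk_anticomm (a b : FreeDialgebra k X) : IsRelator e (brk a b + brk b a)
  | leibniz (a b c : FreeDialgebra k X) :
      IsRelator e (dot (brk a b) c + dot b (brk a c)
        - dot (dot (brk a (ofWord (.gen e))) b) c - brk a (dot b c))
  | jacobi (a b c : FreeDialgebra k X) :
      IsRelator e (brk (brk a b) c + brk b (brk a c) - brk a (brk b c))

/-- The ideal generated by the relators: the smallest ideal containing all of them. -/
def relIdeal (k : Type*) [Field k] {X : Type} (e : X) : Submodule k (FreeDialgebra k X) :=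
  sInf {J | IsIdeal J ∧ ∀ z, IsRelator e z → z ∈ J}

end

end FreeDialgebra

/-- The free unital generalized Poisson algebra over `k` on `1, x₁, …, xₙ`. The alphabet is
`Option (Fin n)`: the letter `none` is the unit `1`, and `some i` is the variable of index `i`. -/
noncomputable abbrev FreeGenPoisson (k : Type*) [Field k] (n : ℕ) : Type _ :=
  FreeDialgebra k (Option (Fin n)) ⧸ FreeDialgebra.relIdeal k (none : Option (Fin n))

/-- The multihomogeneous component `GenP(n)` of degree one in each of `1, x₁, …, xₙ`: the span of
the products of bracket words other than the word `1` that together contain each of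
`1, x₁, …, xₙ` exactly once. -/
noncomputable def genPComponent (k : Type*) [Field k] (n : ℕ) : Submodule k (FreeGenPoisson k n) :=
  Submodule.span k
    {f | ∃ w : DiWord (Option (Fin n)), w.IsLieProduct none ∧ (∀ x, w.count x = 1) ∧
      f = Submodule.Quotient.mk (FreeDialgebra.ofWord w)}

/-! Rank the letters with the unit `e` highest. Spanning: by anticommutativity and Jacobi, a bracket
word is a combination of left-normed ones starting with its least letter, which is not `e` because
the one-letter word `e` is excluded. Sorting these commuting blocks by decreasing first letter and
concatenating gives a word with each letter once, not starting with `e`; cutting at left-to-right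
minima recovers the blocks. There are `(n+1)! - n! = n * n!` such words.

Independence: the commutator Poisson bracket on polynomials in words is deformed by the Euler
derivation so that `1` acts as the variable `[e]`. The result is again a generalized Poisson algebra
(`jacobiator_eq_zero`), so the free one maps to it. There a left-normed block is its own word plus
words headed by a letter above its least one (`evalWord_leftNormed_sub_mem`); killing the latter
sends the block products to distinct monomials. -/

namespace WordPoisson

/-! ### The word model and its generalized Poisson bracket -/

open MvPolynomial

noncomputable section

variable {k : Type*} [Field k] {X : Type}

/-- The Poisson bracket on the symmetric algebra of the free associative algebra with its
commutator bracket: `{u, v} = uv - vu` on words. -/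
def poisson (k : Type*) [Field k] (X : Type) :
    Derivation k (MvPolynomial (List X) k)
      (Derivation k (MvPolynomial (List X) k) (MvPolynomial (List X) k)) :=
  mkDerivation k fun u => mkDerivation k fun v =>
    (MvPolynomial.X (u ++ v) - MvPolynomial.X (v ++ u) : MvPolynomial (List X) k)

theorem poisson_X_X (u v : List X) :
    poisson k X (.X u) (.X v) = .X (u ++ v) - .X (v ++ u) := by
  simp [poisson, mkDerivation_X]

theorem poisson_anticomm (f g : MvPolynomial (List X) k) :
    poisson k X f g + poisson k X g f = 0 := by
  induction f using MvPolynomial.induction_on with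
  | C r => simp [← algebraMap_eq]
  | add p q hp hq =>
    rw [map_add, map_add, Derivation.add_apply]
    linear_combination hp + hq
  | mul_X p u hp =>
    have hu : poisson k X (.X u) g + poisson k X g (.X u) = 0 := by
      clear hp
      induction g using MvPolynomial.induction_on with
      | C r => simp [← algebraMap_eq]
      | add p q hp hq =>
        rw [map_add, map_add, Derivation.add_apply]
        linear_combination hp + hq
      | mul_X q v hq =>
        simp only [Derivation.leibniz, Derivation.add_apply, Derivation.smul_apply, smul_eq_mul,
          poisson_X_X] at hq ⊢
        linear_combination .X v * hq
    simp only [Derivation.leibniz, Derivation.add_apply, Derivation.smul_apply, smul_eq_mul]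
    linear_combination p * hu + .X u * hp

/-- The Euler derivation, fixing every variable. -/
def euler (k : Type*) [Field k] (X : Type) :
    Derivation k (MvPolynomial (List X) k) (MvPolynomial (List X) k) :=
  mkDerivation k MvPolynomial.X

theorem euler_X (u : List X) : euler k X (.X u) = .X u := by
  simp [euler, mkDerivation_X]

/-- The generalized Poisson bracket in which the unit acts as the letter `e`. -/
def bracket (k : Type*) [Field k] {X : Type} (e : X) :
    MvPolynomial (List X) k →ₗ[k] MvPolynomial (List X) k →ₗ[k] MvPolynomial (List X) k :=
  LinearMap.mk₂ k
    (fun f g => poisson k X f g + poisson k X f (.X [e]) * (g - euler k X g)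
      - (f - euler k X f) * poisson k X g (.X [e]))
    (fun a b c => by simp only [map_add, Derivation.add_apply]; ring)
    (fun r a b => by
      simp only [Derivation.map_smul, Derivation.smul_apply]
      simp only [smul_eq_C_mul]
      ring)
    (fun a b c => by simp only [map_add, Derivation.add_apply]; ring)
    (fun r a b => by
      simp only [Derivation.map_smul, Derivation.smul_apply]
      simp only [smul_eq_C_mul]
      ring)

variable (e : X)

theorem bracket_apply (f g : MvPolynomial (List X) k) :
    bracket k e f g = poisson k X f g + poisson k X f (.X [e]) * (g - euler k X g)
      - (f - euler k X f) * poisson k X g (.X [e]) := rfl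

theorem bracket_anticomm (f g : MvPolynomial (List X) k) :
    bracket k e f g = - bracket k e g f := by
  rw [bracket_apply, bracket_apply]
  linear_combination poisson_anticomm f g

/-- The Euler derivation kills `1`, so only the middle term survives; the correction terms are there
for this. -/
theorem bracket_one (f : MvPolynomial (List X) k) :
    bracket k e f 1 = poisson k X f (.X [e]) := by
  simp [bracket_apply]

/-- With `E` the Euler derivation, `(1 - E)(bc) = (1 - E)(b) c + b (1 - E)(c) - bc`, which produces
the extra term; all else is a derivation in the second argument. -/
theorem bracket_mul (a b c : MvPolynomial (List X) k) :
    bracket k e a (b * c)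
      = bracket k e a b * c + b * bracket k e a c - bracket k e a 1 * b * c := by
  rw [bracket_one]
  simp only [bracket_apply, Derivation.leibniz, Derivation.add_apply, Derivation.smul_apply,
    smul_eq_mul]
  ring

/-- The failure of the Jacobi identity. -/
def jacobiator (a b c : MvPolynomial (List X) k) : MvPolynomial (List X) k :=
  bracket k e (bracket k e a b) c + bracket k e b (bracket k e a c)
    - bracket k e a (bracket k e b c)

theorem jacobiator_rotate (a b c : MvPolynomial (List X) k) :
    jacobiator e b c a = jacobiator e a b c := by
  unfold jacobiator
  rw [bracket_anticomm e (bracket k e b c) a, bracket_anticomm e b a, bracket_anticomm e c a,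
    bracket_anticomm e (bracket k e a b) c]
  simp only [map_neg]
  ring

/-- The mixed terms cancel, so vanishing need only be tested on `1` and the variables. -/
theorem jacobiator_mul (a b c d : MvPolynomial (List X) k) :
    jacobiator e a b (c * d)
      = jacobiator e a b c * d + c * jacobiator e a b d - jacobiator e a b 1 * c * d := by
  simp only [jacobiator, bracket_mul, map_add, map_sub]
  ring

theorem jacobiator_eq_zero_of_generators {a b : MvPolynomial (List X) k}
    (h1 : jacobiator e a b 1 = 0) (hX : ∀ u, jacobiator e a b (.X u) = 0)
    (c : MvPolynomial (List X) k) : jacobiator e a b c = 0 := by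
  induction c using MvPolynomial.induction_on with
  | C r =>
    have : (C r : MvPolynomial (List X) k) = r • 1 := by simp [smul_eq_C_mul]
    rw [this]
    simp only [jacobiator, map_smul, ← smul_add, ← smul_sub]
    rw [jacobiator] at h1
    rw [h1, smul_zero]
  | add p q hp hq =>
    simp only [jacobiator, map_add] at hp hq ⊢
    linear_combination hp + hq
  | mul_X p u hp => rw [jacobiator_mul, hp, hX, h1]; simp

/-- `f` is the generator attached to the word `u`, the unit being attached to the word `e`. -/
def IsGenerator (f : MvPolynomial (List X) k) (u : List X) : Prop :=
  f = .X u ∨ (f = 1 ∧ u = [e])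

/-- The corrections vanish on variables, which `euler` fixes, and turn `1` into `[e]`: on generators
only a commutator remains. -/
theorem bracket_generators {f g : MvPolynomial (List X) k} {u v : List X}
    (hf : IsGenerator e f u) (hg : IsGenerator e g v) :
    bracket k e f g = .X (u ++ v) - .X (v ++ u) := by
  rcases hf with rfl | ⟨rfl, rfl⟩ <;> rcases hg with rfl | ⟨rfl, rfl⟩ <;>
    simp [bracket_apply, poisson_X_X, euler_X]

theorem jacobiator_generators {f g h : MvPolynomial (List X) k} {u v w : List X}
    (hf : IsGenerator e f u) (hg : IsGenerator e g v) (hh : IsGenerator e h w) :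
    jacobiator e f g h = 0 := by
  have hX : ∀ u : List X, IsGenerator e (.X u : MvPolynomial (List X) k) u := fun u => .inl rfl
  simp only [jacobiator, bracket_generators e hf hg, bracket_generators e hf hh,
    bracket_generators e hg hh, map_sub, LinearMap.sub_apply, bracket_generators e (hX _) hh,
    bracket_generators e hg (hX _), bracket_generators e hf (hX _), List.append_assoc]
  ring

theorem jacobiator_eq_zero (a b c : MvPolynomial (List X) k) : jacobiator e a b c = 0 := by
  have hX : ∀ u : List X, IsGenerator e (.X u : MvPolynomial (List X) k) u := fun u => .inl rfl
  have h1 : IsGenerator e (1 : MvPolynomial (List X) k) [e] := .inr ⟨rfl, rfl⟩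
  -- Arguments are freed one at a time: `s1` frees the last, and cyclic rotation brings the next one
  -- into that position.
  have s1 {f g : MvPolynomial (List X) k} {u v} (hf : IsGenerator e f u)
      (hg : IsGenerator e g v) (c) : jacobiator e f g c = 0 :=
    jacobiator_eq_zero_of_generators e (jacobiator_generators e hf hg h1)
      (fun w => jacobiator_generators e hf hg (hX w)) c
  have s2 {f : MvPolynomial (List X) k} {u} (hf : IsGenerator e f u)
      (b c : MvPolynomial (List X) k) : jacobiator e c f b = 0 :=
    jacobiator_eq_zero_of_generators e
      ((jacobiator_rotate e c f 1).symm.trans (s1 hf h1 c))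
      (fun w => (jacobiator_rotate e c f (.X w)).symm.trans (s1 hf (hX w) c)) b
  exact jacobiator_eq_zero_of_generators e
    ((jacobiator_rotate e a b 1).symm.trans (s2 h1 a b))
    (fun w => (jacobiator_rotate e a b (.X w)).symm.trans (s2 (hX w) a b)) c

/-! ### Evaluation in the model -/

/-- The value of a word in the model, the letter `e` becoming the unit. -/
def evalWord (k : Type*) [Field k] {X : Type} (e : X) [DecidableEq X] :
    DiWord X → MvPolynomial (List X) k
  | .gen x => if x = e then 1 else .X [x]
  | .dot u v => evalWord k e u * evalWord k e v
  | .brk u v => bracket k e (evalWord k e u) (evalWord k e v)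

variable [DecidableEq X]

/-- The homomorphism from the free dialgebra to the model. -/
def eval (k : Type*) [Field k] {X : Type} (e : X) [DecidableEq X] :
    FreeDialgebra k X →ₗ[k] MvPolynomial (List X) k :=
  Finsupp.linearCombination k (evalWord k e)

theorem eval_ofWord (w : DiWord X) : eval k e (FreeDialgebra.ofWord w) = evalWord k e w := by
  simp [eval, FreeDialgebra.ofWord]

theorem eval_dot (a b : FreeDialgebra k X) :
    eval k e (FreeDialgebra.dot a b) = eval k e a * eval k e b := by
  suffices FreeDialgebra.dot.compr₂ (eval k e)
      = (LinearMap.mul k (MvPolynomial (List X) k)).compl₁₂ (eval k e) (eval k e) from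
    LinearMap.congr_fun₂ this a b
  ext u v : 4
  simp [eval, FreeDialgebra.dot, evalWord]

theorem eval_brk (a b : FreeDialgebra k X) :
    eval k e (FreeDialgebra.brk a b) = bracket k e (eval k e a) (eval k e b) := by
  suffices FreeDialgebra.brk.compr₂ (eval k e)
      = (bracket k e).compl₁₂ (eval k e) (eval k e) from
    LinearMap.congr_fun₂ this a b
  ext u v : 4
  simp [eval, FreeDialgebra.brk, evalWord]

theorem relIdeal_le_ker_eval : FreeDialgebra.relIdeal k e ≤ LinearMap.ker (eval k e) := by
  refine sInf_le ⟨fun a z hz => ?_, fun z hz => ?_⟩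
  · simp only [LinearMap.mem_ker, eval_dot, eval_brk] at hz ⊢
    simp [hz]
  · rw [LinearMap.mem_ker]
    have he : eval k e (FreeDialgebra.ofWord (.gen e)) = 1 := by simp [eval_ofWord, evalWord]
    cases hz with
    | dot_comm a b => simp only [map_sub, eval_dot]; ring
    | dot_assoc a b c => simp only [map_sub, eval_dot]; ring
    | one_dot a => simp [eval_dot, he]
    | brk_anticomm a b =>
      rw [map_add, eval_brk, eval_brk, bracket_anticomm]
      ring
    | leibniz a b c =>
      simp only [map_sub, map_add, eval_dot, eval_brk, he, bracket_mul]
      ring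
    | jacobi a b c =>
      simp only [map_sub, map_add, eval_brk]
      exact jacobiator_eq_zero e _ _ _

end

end WordPoisson

/-! ### Operations on the quotient -/

namespace FreeDialgebra

noncomputable section

variable {k : Type*} [Field k] {X : Type}

theorem dot_ofWord (u v : DiWord X) :
    dot (ofWord u : FreeDialgebra k X) (ofWord v) = ofWord (.dot u v) := by
  simp [dot, ofWord]

theorem brk_ofWord (u v : DiWord X) :
    brk (ofWord u : FreeDialgebra k X) (ofWord v) = ofWord (.brk u v) := by
  simp [brk, ofWord]

theorem isIdeal_relIdeal (e : X) : IsIdeal (relIdeal k e) := by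
  intro a z hz
  simp only [relIdeal, Submodule.mem_sInf] at hz ⊢
  exact ⟨fun J hJ => (hJ.1 a z (hz J hJ)).1, fun J hJ => (hJ.1 a z (hz J hJ)).2.1,
    fun J hJ => (hJ.1 a z (hz J hJ)).2.2.1, fun J hJ => (hJ.1 a z (hz J hJ)).2.2.2⟩

theorem relator_mem (e : X) {z : FreeDialgebra k X} (hz : IsRelator e z) : z ∈ relIdeal k e :=
  Submodule.mem_sInf.2 fun _ hJ => hJ.2 z hz

end

end FreeDialgebra

/-- The bilinear map induced on a quotient by a bilinear map for which the kernel is an ideal. -/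
def Submodule.mapQ₂ {k M : Type*} [CommRing k] [AddCommGroup M] [Module k M] (J : Submodule k M)
    (f : M →ₗ[k] M →ₗ[k] M) (hl : ∀ a, ∀ z ∈ J, f a z ∈ J) (hr : ∀ a, ∀ z ∈ J, f z a ∈ J) :
    M ⧸ J →ₗ[k] M ⧸ J →ₗ[k] M ⧸ J :=
  J.liftQ
    { toFun := fun a => J.mapQ J (f a) (hl a)
      map_add' := fun a b => by ext; simp
      map_smul' := fun r a => by ext; simp }
    (fun z hz => by
      ext a
      simpa using hr a z hz)

/-- The free unital generalized Poisson algebra on the alphabet `X`, the letter `e` being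
the unit. -/
abbrev FreeUnitalGenPoisson (k : Type*) [Field k] {X : Type} (e : X) : Type _ :=
  FreeDialgebra k X ⧸ FreeDialgebra.relIdeal k e

namespace FreeUnitalGenPoisson

noncomputable section

open FreeDialgebra

variable {k : Type*} [Field k] {X : Type} {e : X}

/-- The product of the free unital generalized Poisson algebra. -/
def mul : FreeUnitalGenPoisson k e →ₗ[k] FreeUnitalGenPoisson k e →ₗ[k] FreeUnitalGenPoisson k e :=
  (relIdeal k e).mapQ₂ dot (fun a z hz => (isIdeal_relIdeal e a z hz).1)
    (fun a z hz => (isIdeal_relIdeal e a z hz).2.1)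

/-- The bracket of the free unital generalized Poisson algebra. -/
def lie : FreeUnitalGenPoisson k e →ₗ[k] FreeUnitalGenPoisson k e →ₗ[k] FreeUnitalGenPoisson k e :=
  (relIdeal k e).mapQ₂ brk (fun a z hz => (isIdeal_relIdeal e a z hz).2.2.1)
    (fun a z hz => (isIdeal_relIdeal e a z hz).2.2.2)

theorem mul_mk (a b : FreeDialgebra k X) :
    mul (e := e) (Submodule.Quotient.mk a) (Submodule.Quotient.mk b)
      = Submodule.Quotient.mk (dot a b) := rfl

theorem lie_mk (a b : FreeDialgebra k X) :
    lie (e := e) (Submodule.Quotient.mk a) (Submodule.Quotient.mk b)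
      = Submodule.Quotient.mk (brk a b) := rfl

instance : CommMonoid (FreeUnitalGenPoisson k e) where
  mul a b := mul a b
  one := Submodule.Quotient.mk (ofWord (.gen e))
  mul_assoc a b c := by
    induction a using Submodule.Quotient.induction_on with | _ a
    induction b using Submodule.Quotient.induction_on with | _ b
    induction c using Submodule.Quotient.induction_on with | _ c
    exact (Submodule.Quotient.eq _).2 (relator_mem e (.dot_assoc a b c))
  mul_comm a b := by
    induction a using Submodule.Quotient.induction_on with | _ a
    induction b using Submodule.Quotient.induction_on with | _ b
    exact (Submodule.Quotient.eq _).2 (relator_mem e (.dot_comm a b))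
  one_mul a := by
    induction a using Submodule.Quotient.induction_on with | _ a
    exact (Submodule.Quotient.eq _).2 (relator_mem e (.one_dot a))
  mul_one a := by
    induction a using Submodule.Quotient.induction_on with | _ a
    refine (Submodule.Quotient.eq _).2 ?_
    have h := add_mem (relator_mem (k := k) e (.dot_comm a (ofWord (.gen e))))
      (relator_mem (k := k) e (.one_dot a))
    simpa using h

theorem mul_def (a b : FreeUnitalGenPoisson k e) : a * b = mul a b := rfl

theorem lie_anticomm (a b : FreeUnitalGenPoisson k e) : lie a b = - lie b a := by
  induction a using Submodule.Quotient.induction_on with | _ a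
  induction b using Submodule.Quotient.induction_on with | _ b
  rw [eq_neg_iff_add_eq_zero]
  exact (Submodule.Quotient.mk_eq_zero _).2 (relator_mem e (.brk_anticomm a b))

theorem lie_lie (a b c : FreeUnitalGenPoisson k e) :
    lie a (lie b c) = lie (lie a b) c - lie (lie a c) b := by
  have h : lie (lie a b) c + lie b (lie a c) - lie a (lie b c) = 0 := by
    induction a using Submodule.Quotient.induction_on with | _ a
    induction b using Submodule.Quotient.induction_on with | _ b
    induction c using Submodule.Quotient.induction_on with | _ c
    exact (Submodule.Quotient.mk_eq_zero _).2 (relator_mem e (.jacobi a b c))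
  rw [lie_anticomm b] at h
  rw [sub_eq_zero] at h
  rw [← h, sub_eq_add_neg]

variable (k e) in
/-- The class of a word. -/
def ofWord (w : DiWord X) : FreeUnitalGenPoisson k e :=
  Submodule.Quotient.mk (FreeDialgebra.ofWord w)

theorem ofWord_dot (u v : DiWord X) :
    ofWord k e (.dot u v) = ofWord k e u * ofWord k e v := by
  rw [mul_def, ofWord, ofWord, ofWord, mul_mk, dot_ofWord]

theorem ofWord_brk (u v : DiWord X) :
    ofWord k e (.brk u v) = lie (ofWord k e u) (ofWord k e v) := by
  rw [ofWord, ofWord, ofWord, lie_mk, brk_ofWord]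

end

end FreeUnitalGenPoisson

/-! ### Letters and left-normed words -/

namespace DiWord

variable {X : Type}

/-- The multiset of letters of a word. -/
def letters : DiWord X → Multiset X
  | gen x => {x}
  | dot u v => letters u + letters v
  | brk u v => letters u + letters v

theorem count_letters [DecidableEq X] (x : X) (w : DiWord X) :
    w.letters.count x = w.count x := by
  induction w with
  | gen y => simp [letters, count, Multiset.count_singleton, eq_comm]
  | dot u v hu hv => simp [letters, count, hu, hv]
  | brk u v hu hv => simp [letters, count, hu, hv]

theorem letters_ne_zero (w : DiWord X) : w.letters ≠ 0 := by
  induction w with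
  | gen y => simp [letters]
  | dot u v hu hv => simp [letters, hu]
  | brk u v hu hv => simp [letters, hu]

theorem IsLie.eq_gen_of_letters {w : DiWord X} (hw : w.IsLie) {x : X} (h : w.letters = {x}) :
    w = DiWord.gen x := by
  cases hw with
  | gen y => simpa [letters] using h
  | @brk u v hu hv =>
    have := congrArg Multiset.card h
    have h1 := Multiset.card_pos.2 u.letters_ne_zero
    have h2 := Multiset.card_pos.2 v.letters_ne_zero
    simp [letters] at this
    omega

/-- The left-normed bracket word `{…{{a, t₁}, t₂}, …}` of `(a, t)`. -/
def leftNormed (p : X × List X) : DiWord X :=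
  p.2.foldl (fun u c => brk u (gen c)) (gen p.1)

theorem leftNormed_concat (a : X) (t : List X) (c : X) :
    leftNormed (a, t ++ [c]) = brk (leftNormed (a, t)) (gen c) := by
  simp [leftNormed]

theorem isLie_leftNormed (p : X × List X) : (leftNormed p).IsLie := by
  obtain ⟨a, t⟩ := p
  induction t using List.reverseRecOn with
  | nil => exact IsLie.gen a
  | append_singleton t c ih =>
    rw [leftNormed_concat]
    exact IsLie.brk ih (IsLie.gen c)

theorem letters_leftNormed (p : X × List X) :
    (leftNormed p).letters = ((p.1 :: p.2 : List X) : Multiset X) := by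
  obtain ⟨a, t⟩ := p
  induction t using List.reverseRecOn with
  | nil => rfl
  | append_singleton t c ih =>
    rw [leftNormed_concat, letters, ih, letters, ← Multiset.coe_singleton, Multiset.coe_add]
    simp

end DiWord

/-! ### Spanning by products of blocks -/

namespace FreeUnitalGenPoisson

noncomputable section

open DiWord

variable {k : Type*} [Field k] {X : Type} {e : X}

/-- Jacobi replaces bracketing with `{u, v}` by successive bracketings with `u` and `v` in both
orders, so `a` stays in front. -/
theorem lie_leftNormed_mem_span (a : X) {v : DiWord X} (hv : v.IsLie) (t : List X) :
    lie (ofWord k e (leftNormed (a, t))) (ofWord k e v) ∈ Submodule.span k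
      {f | ∃ s : List X, (s : Multiset X) = t + v.letters ∧ f = ofWord k e (leftNormed (a, s))} := by
  induction hv generalizing t with
  | gen c =>
    refine Submodule.subset_span ⟨t ++ [c], ?_, ?_⟩
    · simp [letters, ← Multiset.coe_singleton, Multiset.coe_add]
    · rw [leftNormed_concat, ofWord_brk]
  | @brk u v hu hv ihu ihv =>
    rw [ofWord_brk, lie_lie]
    have key {p q : DiWord X}
        (hp : ∀ t : List X, lie (ofWord k e (leftNormed (a, t))) (ofWord k e p) ∈ Submodule.span k
          {f | ∃ s : List X, (s : Multiset X) = t + p.letters ∧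
            f = ofWord k e (leftNormed (a, s))})
        (hq : ∀ t : List X, lie (ofWord k e (leftNormed (a, t))) (ofWord k e q) ∈ Submodule.span k
          {f | ∃ s : List X, (s : Multiset X) = t + q.letters ∧
            f = ofWord k e (leftNormed (a, s))}) :
        lie (lie (ofWord k e (leftNormed (a, t))) (ofWord k e p)) (ofWord k e q) ∈
          Submodule.span k {f | ∃ s : List X, (s : Multiset X) = t + (p.letters + q.letters) ∧
            f = ofWord k e (leftNormed (a, s))} := by
      refine LinearMap.BilinMap.apply_apply_mem_of_mem_span _ _ {ofWord k e q} lie ?_ _ _ (hp t)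
        (Submodule.mem_span_singleton_self _)
      rintro _ ⟨s, hs, rfl⟩ _ rfl
      refine Submodule.span_mono ?_ (hq s)
      rintro _ ⟨s', hs', rfl⟩
      exact ⟨s', by rw [hs', hs, add_assoc], rfl⟩
    refine sub_mem (key ihu ihv) ?_
    rw [letters, add_comm u.letters]
    exact key ihv ihu

/-- Anticommutativity moves the factor containing `a` to the left; the previous lemma then unfolds
the other factor. -/
theorem ofWord_mem_span_leftNormed {u : DiWord X} (hu : u.IsLie) {a : X} (ha : a ∈ u.letters) :
    ofWord k e u ∈ Submodule.span k
      {f | ∃ t : List X, (a :: t : List X) = u.letters ∧ f = ofWord k e (leftNormed (a, t))} := by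
  induction hu with
  | gen c =>
    obtain rfl : a = c := by simpa [letters] using ha
    exact Submodule.subset_span ⟨[], rfl, rfl⟩
  | @brk u v hu hv ihu ihv =>
    have key {p q : DiWord X} (hq : q.IsLie) (hp : ofWord k e p ∈ Submodule.span k
        {f | ∃ t : List X, (a :: t : List X) = p.letters ∧ f = ofWord k e (leftNormed (a, t))}) :
        lie (ofWord k e p) (ofWord k e q) ∈ Submodule.span k
          {f | ∃ t : List X, (a :: t : List X) = p.letters + q.letters ∧
            f = ofWord k e (leftNormed (a, t))} := by
      refine LinearMap.BilinMap.apply_apply_mem_of_mem_span _ _ {ofWord k e q} lie ?_ _ _ hp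
        (Submodule.mem_span_singleton_self _)
      rintro _ ⟨s, hs, rfl⟩ _ rfl
      refine Submodule.span_mono ?_ (lie_leftNormed_mem_span a hq s)
      rintro _ ⟨s', hs', rfl⟩
      exact ⟨s', by rw [← hs, ← Multiset.cons_coe, hs', ← Multiset.cons_coe, Multiset.cons_add],
        rfl⟩
    rw [ofWord_brk]
    rcases Multiset.mem_add.1 ha with h | h
    · exact key hv (ihu h)
    · rw [lie_anticomm, letters, add_comm u.letters]
      exact neg_mem (key hu (ihv h))

/-- The block `(a, t)` starts with its letter of least rank, which is not `e`. -/
def IsBlock (r : X → ℕ) (e : X) (p : X × List X) : Prop :=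
  p.1 ≠ e ∧ ∀ b ∈ p.2, r p.1 < r b

/-- The concatenation of a list of blocks. -/
def concat (L : List (X × List X)) : List X := L.flatMap fun p => p.1 :: p.2

variable (k e) in
/-- The product of the left-normed brackets of a list of blocks. -/
def blockProd (L : List (X × List X)) : FreeUnitalGenPoisson k e :=
  (L.map fun p => ofWord k e (leftNormed p)).prod

theorem ofWord_mem_span_blockProd {r : X → ℕ} (hr : Function.Injective r) (he : ∀ x, r x ≤ r e)
    {w : DiWord X} (hw : w.IsLieProduct e) (hn : w.letters.Nodup) :
    ofWord k e w ∈ Submodule.span k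
      {f | ∃ L : List (X × List X), (∀ p ∈ L, IsBlock r e p) ∧ (concat L : Multiset X) = w.letters ∧
        f = blockProd k e L} := by
  induction hw with
  | @lie u hu hne =>
    obtain ⟨a, ha, hmin⟩ : ∃ a ∈ u.letters, ∀ b ∈ u.letters, r a ≤ r b := by
      classical
      obtain ⟨x, hx⟩ := Multiset.exists_mem_of_ne_zero u.letters_ne_zero
      obtain ⟨a, ha, h⟩ := u.letters.toFinset.exists_min_image r ⟨x, by simpa using hx⟩
      exact ⟨a, by simpa using ha, fun b hb => h b (by simpa using hb)⟩
    refine Submodule.span_mono ?_ (ofWord_mem_span_leftNormed hu ha)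
    rintro _ ⟨t, ht, rfl⟩
    have hnd : (a :: t).Nodup := by rwa [← Multiset.coe_nodup, ht]
    have hlt : ∀ b ∈ t, r a < r b := fun b hb =>
      lt_of_le_of_ne (hmin b (by rw [← ht]; simp [hb])) fun h =>
        (List.nodup_cons.1 hnd).1 (hr h ▸ hb)
    refine ⟨[(a, t)], ?_, by simpa [concat] using ht, by simp [blockProd]⟩
    simp only [List.mem_singleton, forall_eq]
    refine ⟨?_, hlt⟩
    -- If the least letter is `e`, of highest rank, no other letter fits and the word is the
    -- excluded `e`.
    rintro rfl
    obtain rfl : t = [] := List.eq_nil_iff_forall_not_mem.2 fun b hb =>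
      (hlt b hb).not_ge (he b)
    exact hne (hu.eq_gen_of_letters ht.symm)
  | @dot u v hu hv ihu ihv =>
    rw [letters, Multiset.nodup_add] at hn
    rw [ofWord_dot, mul_def]
    refine LinearMap.BilinMap.apply_apply_mem_of_mem_span _ _ _ mul ?_ _ _ (ihu hn.1) (ihv hn.2.1)
    rintro _ ⟨L, hL, hc, rfl⟩ _ ⟨L', hL', hc', rfl⟩
    refine Submodule.subset_span ⟨L ++ L', ?_, ?_, ?_⟩
    · exact fun p hp => (List.mem_append.1 hp).elim (hL p) (hL' p)
    · rw [letters, ← hc, ← hc']; simp [concat]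
    · rw [← mul_def]; simp [blockProd]

/-- The empty list must be excluded: its product is the unit, the class of the forbidden word `e`.
-/
theorem exists_isLieProduct_blockProd {r : X → ℕ} {L : List (X × List X)}
    (hL : ∀ p ∈ L, IsBlock r e p) (hne : L ≠ []) :
    ∃ w : DiWord X, w.IsLieProduct e ∧ w.letters = concat L ∧ blockProd k e L = ofWord k e w := by
  induction L with
  | nil => exact absurd rfl hne
  | cons p L ih =>
    have hp : (leftNormed p).IsLieProduct e := by
      refine .lie (isLie_leftNormed p) fun h => (hL p (by simp)).1 ?_
      have h1 := letters_leftNormed p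
      rw [h, letters, ← Multiset.coe_singleton, Multiset.coe_eq_coe] at h1
      have := List.singleton_perm.1 h1
      simp_all
    rcases eq_or_ne L [] with rfl | hLne
    · exact ⟨leftNormed p, hp, by simp [letters_leftNormed, concat], by simp [blockProd]⟩
    · obtain ⟨w, hw, hl, hb⟩ := ih (fun q hq => hL q (by simp [hq])) hLne
      refine ⟨.dot (leftNormed p) w, .dot hp hw, ?_, ?_⟩
      · rw [letters, hl, letters_leftNormed, Multiset.coe_add]; simp [concat]
      · rw [ofWord_dot, ← hb]; simp [blockProd]

end

end FreeUnitalGenPoisson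

/-! ### Cutting words at left-to-right minima -/

namespace FreeUnitalGenPoisson

noncomputable section

open DiWord WordPoisson

variable {k : Type*} [Field k] {X : Type} {e : X}

/-- The blocks of a list: it is cut before each left-to-right minimum of the rank. -/
def blocks (r : X → ℕ) : List X → List (X × List X)
  | [] => []
  | a :: t => (a, t.takeWhile fun b => decide (r a < r b)) ::
      blocks r (t.dropWhile fun b => decide (r a < r b))
termination_by w => w.length
decreasing_by exact Nat.lt_succ_of_le (List.length_dropWhile_le _ _)

theorem concat_blocks (r : X → ℕ) (w : List X) : concat (blocks r w) = w := by
  induction w using blocks.induct r with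
  | case1 => simp [blocks, concat]
  | case2 a t ih =>
    rw [blocks]
    rw [concat] at ih ⊢
    rw [List.flatMap_cons, ih]
    simp

theorem head_blocks_le (r : X → ℕ) (a : X) (t : List X) :
    ∀ p ∈ blocks r (a :: t), r p.1 ≤ r a := by
  suffices ∀ w : List X, ∀ a t, w = a :: t → ∀ p ∈ blocks r w, r p.1 ≤ r a from this _ a t rfl
  intro w
  induction w using blocks.induct r with
  | case1 => simp
  | case2 a t ih =>
    rintro a' t' ⟨rfl, rfl⟩ p hp
    rw [blocks, List.mem_cons] at hp
    rcases hp with rfl | hp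
    · exact le_rfl
    · cases hd : t.dropWhile fun b => decide (r a < r b) with
      | nil => rw [hd, blocks] at hp; simp at hp
      | cons b s =>
        have hb := List.head_dropWhile_not (p := fun b => decide (r a < r b)) (l := t) (by simp [hd])
        simp only [hd, List.head_cons, decide_eq_false_iff_not, not_lt] at hb
        exact (ih b s hd p hp).trans hb

theorem forall_mem_blocks (r : X → ℕ) (w : List X) :
    ∀ p ∈ blocks r w, ∀ b ∈ p.2, r p.1 < r b := by
  induction w using blocks.induct r with
  | case1 => simp [blocks]
  | case2 a t ih =>
    intro p hp
    rw [blocks, List.mem_cons] at hp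
    rcases hp with rfl | hp
    · intro b hb
      simpa using List.mem_takeWhile_imp hb
    · exact ih p hp

theorem pairwise_blocks {r : X → ℕ} (hr : Function.Injective r) {w : List X} (hw : w.Nodup) :
    (blocks r w).Pairwise fun p q => r q.1 < r p.1 := by
  induction w using blocks.induct r with
  | case1 => simp [blocks]
  | case2 a t ih =>
    rw [List.nodup_cons] at hw
    rw [blocks, List.pairwise_cons]
    refine ⟨fun p hp => ?_, ih (hw.2.sublist (List.dropWhile_sublist _))⟩
    have hle := head_blocks_le r a t p (by rw [blocks]; exact List.mem_cons_of_mem _ hp)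
    refine lt_of_le_of_ne hle fun h => hw.1 ?_
    have hmem : p.1 ∈ concat (blocks r (t.dropWhile fun b => decide (r a < r b))) :=
      List.mem_flatMap.2 ⟨p, hp, by simp⟩
    rw [concat_blocks] at hmem
    rw [hr h] at hmem
    exact (List.dropWhile_sublist _).subset hmem

theorem blocks_concat {r : X → ℕ} {L : List (X × List X)}
    (hL : ∀ p ∈ L, ∀ b ∈ p.2, r p.1 < r b) (hs : L.Pairwise fun p q => r q.1 ≤ r p.1) :
    blocks r (concat L) = L := by
  induction L with
  | nil => simp [concat, blocks]
  | cons p L ih =>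
    obtain ⟨a, t⟩ := p
    rw [List.pairwise_cons] at hs
    have ih' := ih (fun q hq => hL q (by simp [hq])) hs.2
    have ht : ∀ b ∈ t, decide (r a < r b) = true := fun b hb => by
      simpa using hL (a, t) (by simp) b hb
    have hc : concat ((a, t) :: L) = a :: (t ++ concat L) := by simp [concat]
    -- The next head has rank at most that of `a`, so the cut falls exactly at the end of `t`.
    have h1 : (concat L).takeWhile (fun b => decide (r a < r b)) = [] ∧
        (concat L).dropWhile (fun b => decide (r a < r b)) = concat L := by
      cases L with
      | nil => simp [concat]
      | cons q L =>
        have := hs.1 q (by simp)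
        simp [concat, this]
    rw [hc, blocks, List.takeWhile_append_of_pos ht, List.dropWhile_append_of_pos ht, h1.1, h1.2,
      ih', List.append_nil]

/-- The words containing each letter exactly once and not starting with `e`. -/
def basisWords (X : Type) [Fintype X] (e : X) : Finset (List X) :=
  haveI := Classical.decEq X
  (Finset.univ : Finset X).toList.permutations.toFinset \
    ((Finset.univ.erase e : Finset X).toList.permutations.toFinset.image (List.cons e))

theorem mem_basisWords [Fintype X] {w : List X} :
    w ∈ basisWords X e ↔ (w : Multiset X) = (Finset.univ : Finset X).val ∧ ∀ t, w ≠ e :: t := by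
  classical
  have h1 : (Finset.univ : Finset X).val = ((Finset.univ : Finset X).toList : Multiset X) := by simp
  simp only [basisWords, Finset.mem_sdiff, List.mem_toFinset, List.mem_permutations,
    Finset.mem_image, not_exists, not_and, h1, Multiset.coe_eq_coe]
  refine and_congr_right fun hw => ⟨fun h t ht => ?_, fun h t _ ht => h t ht.symm⟩
  subst ht
  refine h t ?_ rfl
  rw [← Multiset.coe_eq_coe, ← Multiset.cons_coe, ← h1] at hw
  rw [← Multiset.coe_eq_coe, Finset.coe_toList, Finset.erase_val, ← hw]
  simp

theorem card_basisWords [Fintype X] {n : ℕ} (hn : Fintype.card X = n + 1) :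
    (basisWords X e).card = n * n ! := by
  classical
  have hd (s : Finset X) : s.toList.permutations.toFinset.card = (s.card)! := by
    rw [List.toFinset_card_of_nodup (List.nodup_permutations _ s.nodup_toList),
      List.length_permutations, Finset.length_toList]
  have hsub : (Finset.univ.erase e : Finset X).toList.permutations.toFinset.image (List.cons e)
      ⊆ (Finset.univ : Finset X).toList.permutations.toFinset := by
    intro w hw
    simp only [Finset.mem_image, List.mem_toFinset, List.mem_permutations] at hw ⊢
    obtain ⟨t, ht, rfl⟩ := hw
    rw [← Multiset.coe_eq_coe, Finset.coe_toList] at ht ⊢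
    rw [← Multiset.cons_coe, ht, Finset.erase_val, Multiset.cons_erase (by simp)]
  have : (basisWords X e).card = (n + 1)! - n ! := by
    rw [basisWords]
    convert Finset.card_sdiff_of_subset hsub using 2
    · rw [hd, Finset.card_univ, hn]
    · rw [Finset.card_image_of_injective _ (List.cons_injective), hd,
        Finset.card_erase_of_mem (Finset.mem_univ e), Finset.card_univ, hn, Nat.add_sub_cancel]
  rw [this, Nat.factorial_succ, Nat.succ_mul, Nat.add_sub_cancel]

/-- Heads strictly decrease and `e` ranks highest, so a block headed by `e` could only come first.
-/
theorem isBlock_of_mem_blocks {r : X → ℕ} (hr : Function.Injective r) (he : ∀ x, r x ≤ r e)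
    {w : List X} (hw : w.Nodup) (h : ∀ t, w ≠ e :: t) :
    ∀ p ∈ blocks r w, IsBlock r e p := by
  refine fun p hp => ⟨?_, forall_mem_blocks r w p hp⟩
  rintro rfl
  have hs := pairwise_blocks hr hw
  have hc := concat_blocks r w
  generalize blocks r w = L at *
  cases L with
  | nil => simp at hp
  | cons q L =>
    rcases List.mem_cons.1 hp with rfl | hp
    · exact h _ (by rw [← hc, concat, List.flatMap_cons]; rfl)
    · exact ((List.pairwise_cons.1 hs).1 p hp).not_ge (he _)

theorem ofWord_mem_span_basis [Fintype X] {r : X → ℕ} (hr : Function.Injective r)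
    (he : ∀ x, r x ≤ r e) {w : DiWord X} (hw : w.IsLieProduct e)
    (hn : w.letters = (Finset.univ : Finset X).val) :
    ofWord k e w ∈ Submodule.span k
      (Set.range fun w : basisWords X e => blockProd k e (blocks r w)) := by
  refine Submodule.span_mono ?_ (ofWord_mem_span_blockProd hr he hw (hn ▸ Finset.univ.nodup))
  rintro _ ⟨L, hL, hc, rfl⟩
  -- The product is commutative, so sorting the blocks by decreasing head does not change it.
  let L' := L.insertionSort fun p q => r q.1 ≤ r p.1
  have hperm : L'.Perm L := List.perm_insertionSort _ L
  have hL' : ∀ p ∈ L', IsBlock r e p := fun p hp => hL p (hperm.subset hp)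
  have hs : L'.Pairwise fun p q => r q.1 ≤ r p.1 :=
    haveI : Std.Total fun p q : X × List X => r q.1 ≤ r p.1 := ⟨fun _ _ => le_total _ _⟩
    haveI : IsTrans (X × List X) fun p q => r q.1 ≤ r p.1 := ⟨fun _ _ _ h1 h2 => h2.trans h1⟩
    List.pairwise_insertionSort _ L
  refine ⟨⟨concat L', mem_basisWords.2 ⟨?_, fun t ht => ?_⟩⟩, ?_⟩
  · rw [← hn, ← hc, Multiset.coe_eq_coe]
    exact hperm.flatMap_right _
  · cases hl : L' with
    | nil => simp [hl, concat] at ht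
    | cons p L₀ =>
      refine (hL' p (by simp [hl])).1 ?_
      rw [hl, concat, List.flatMap_cons, List.cons_append] at ht
      exact (List.cons.inj ht).1
  · simp only [blocks_concat (fun p hp => (hL' p hp).2) hs]
    exact (hperm.map _).prod_eq

theorem span_basis_eq [Fintype X] {r : X → ℕ} (hr : Function.Injective r) (he : ∀ x, r x ≤ r e) :
    Submodule.span k {f | ∃ w : DiWord X, w.IsLieProduct e ∧
        w.letters = (Finset.univ : Finset X).val ∧ f = ofWord k e w}
      = Submodule.span k (Set.range fun w : basisWords X e => blockProd k e (blocks r w)) := by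
  refine le_antisymm (Submodule.span_le.2 ?_) (Submodule.span_mono ?_)
  · rintro _ ⟨w, hw, hl, rfl⟩
    exact ofWord_mem_span_basis hr he hw hl
  · rintro _ ⟨⟨w, hw⟩, rfl⟩
    obtain ⟨hw, hh⟩ := mem_basisWords.1 hw
    have hnd : w.Nodup := by rw [← Multiset.coe_nodup, hw]; exact Finset.univ.nodup
    have hne : blocks r w ≠ [] := by
      intro h
      have h1 := concat_blocks r w
      rw [h] at h1
      have h2 : e ∈ (w : Multiset X) := hw ▸ Finset.mem_univ e
      rw [← h1] at h2
      simp [concat] at h2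
    obtain ⟨u, hu, hl, hb⟩ :=
      exists_isLieProduct_blockProd (k := k) (isBlock_of_mem_blocks hr he hnd hh) hne
    exact ⟨u, hu, by rw [hl, concat_blocks, hw], hb⟩

/-! ### Linear independence in the model -/

variable [DecidableEq X]

variable (k e) in
/-- The homomorphism to the word model. -/
def toModel : FreeUnitalGenPoisson k e →ₗ[k] MvPolynomial (List X) k :=
  (FreeDialgebra.relIdeal k e).liftQ (eval k e) (relIdeal_le_ker_eval e)

theorem toModel_ofWord (w : DiWord X) : toModel k e (ofWord k e w) = evalWord k e w :=
  eval_ofWord e w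

theorem toModel_mul (a b : FreeUnitalGenPoisson k e) :
    toModel k e (a * b) = toModel k e a * toModel k e b := by
  induction a using Submodule.Quotient.induction_on with | _ a
  induction b using Submodule.Quotient.induction_on with | _ b
  exact eval_dot e a b

theorem toModel_blockProd (L : List (X × List X)) :
    toModel k e (blockProd k e L) = (L.map fun p => evalWord k e (leftNormed p)).prod := by
  induction L with
  | nil =>
    change toModel k e (ofWord k e (.gen e)) = _
    simp [toModel_ofWord, evalWord]
  | cons p L ih =>
    rw [blockProd, List.map_cons, List.prod_cons, toModel_mul, toModel_ofWord, ← blockProd, ih]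
    rfl

open Classical in
/-- The projection of the model that kills the words not starting with their letter of least
rank. -/
def proj (k : Type*) [Field k] (r : X → ℕ) :
    MvPolynomial (List X) k →ₐ[k] MvPolynomial (List X) k :=
  MvPolynomial.aeval fun u =>
    if ∃ a t, u = a :: t ∧ ∀ b ∈ t, r a < r b then .X u else 0

/-- Bracketing with `c` appends `c` or puts it in front. Once a letter above `a` heads the word,
both operations keep such a head with `a` behind it. -/
theorem evalWord_leftNormed_sub_mem {r : X → ℕ} {a : X} (ha : a ≠ e) (t : List X)
    (ht : ∀ b ∈ t, r a < r b) :
    evalWord k e (leftNormed (a, t)) - .X (a :: t) ∈ Submodule.span k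
      {f | ∃ h s, r a < r h ∧ a ∈ s ∧ f = (.X (h :: s) : MvPolynomial (List X) k)} := by
  induction t using List.reverseRecOn with
  | nil => simp [leftNormed, evalWord, ha]
  | append_singleton t c ih =>
    have hc : r a < r c := ht c (by simp)
    have hgen : IsGenerator e (evalWord k e (.gen c)) [c] := by
      by_cases h : c = e
      · exact .inr ⟨by simp [evalWord, h], by rw [h]⟩
      · exact .inl (by simp [evalWord, h])
    have hX (u : List X) : bracket k e (.X u) (evalWord k e (.gen c))
        = .X (u ++ [c]) - .X (c :: u) := bracket_generators e (.inl rfl) hgen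
    have hmem := LinearMap.BilinMap.apply_apply_mem_of_mem_span
      (Submodule.span k {f | ∃ h s, r a < r h ∧ a ∈ s ∧
        f = (.X (h :: s) : MvPolynomial (List X) k)}) _ {evalWord k e (.gen c)} (bracket k e)
      (by
        rintro _ ⟨h, s, hh, hs, rfl⟩ _ rfl
        rw [hX]
        exact sub_mem (Submodule.subset_span ⟨h, s ++ [c], hh, by simp [hs], rfl⟩)
          (Submodule.subset_span ⟨c, h :: s, hc, by simp [hs], rfl⟩))
      _ _ (ih fun b hb => ht b (by simp [hb])) (Submodule.mem_span_singleton_self _)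
    rw [map_sub, LinearMap.sub_apply, hX] at hmem
    rw [leftNormed_concat, evalWord]
    have hca : (.X (c :: a :: t) : MvPolynomial (List X) k) ∈ Submodule.span k {f | ∃ h s,
        r a < r h ∧ a ∈ s ∧ f = (.X (h :: s) : MvPolynomial (List X) k)} :=
      Submodule.subset_span ⟨c, a :: t, hc, by simp, rfl⟩
    convert sub_mem hmem hca using 1
    rw [List.cons_append]
    ring

theorem proj_evalWord_leftNormed {r : X → ℕ} {p : X × List X} (hp : IsBlock r e p) :
    proj k r (evalWord k e (leftNormed p)) = .X (p.1 :: p.2) := by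
  obtain ⟨a, t⟩ := p
  have h := evalWord_leftNormed_sub_mem (k := k) hp.1 t hp.2
  have h0 : proj k r (evalWord k e (leftNormed (a, t)) - .X (a :: t)) = 0 := by
    refine (Submodule.span_le (p := LinearMap.ker (proj k r).toLinearMap)).2 ?_ h
    rintro _ ⟨h, s, hh, hs, rfl⟩
    simp only [SetLike.mem_coe, LinearMap.mem_ker, AlgHom.toLinearMap_apply, proj,
      MvPolynomial.aeval_X]
    refine if_neg ?_
    rintro ⟨_, _, ⟨rfl, rfl⟩, hlt⟩
    exact (hlt a hs).not_gt hh
  rw [map_sub, sub_eq_zero] at h0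
  rw [h0, proj, MvPolynomial.aeval_X]
  exact if_pos ⟨a, t, rfl, hp.2⟩

theorem proj_toModel_blockProd {r : X → ℕ} {L : List (X × List X)}
    (hL : ∀ p ∈ L, IsBlock r e p) :
    proj k r (toModel k e (blockProd k e L)) = MvPolynomial.monomial
      (Multiset.toFinsupp ((L.map fun p => p.1 :: p.2 : List (List X)) : Multiset (List X))) 1 := by
  rw [toModel_blockProd]
  induction L with
  | nil => simp
  | cons p L ih =>
    rw [List.map_cons, List.prod_cons, map_mul, ih fun q hq => hL q (by simp [hq]),
      proj_evalWord_leftNormed (hL p (by simp)), MvPolynomial.X, MvPolynomial.monomial_mul,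
      List.map_cons, ← Multiset.cons_coe, ← Multiset.singleton_add, map_add,
      Multiset.toFinsupp_singleton, mul_one]

theorem linearIndependent_blockProd [Fintype X] {r : X → ℕ} (hr : Function.Injective r)
    (he : ∀ x, r x ≤ r e) :
    LinearIndependent k fun w : basisWords X e => blockProd k e (blocks r w) := by
  have hnd (w : basisWords X e) : (w : List X).Nodup := by
    rw [← Multiset.coe_nodup, (mem_basisWords.1 w.2).1]
    exact Finset.univ.nodup
  refine LinearIndependent.of_comp ((proj k r).toLinearMap ∘ₗ toModel k e) ?_
  let m (w : basisWords X e) : List X →₀ ℕ := Multiset.toFinsupp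
    (((blocks r w).map fun p => p.1 :: p.2 : List (List X)) : Multiset (List X))
  -- The monomial determines the multiset of blocks; strictly decreasing heads fix their order,
  -- hence the word.
  have hm : Function.Injective m := by
    intro w w' h
    have h1 := Multiset.coe_eq_coe.1 (Multiset.toFinsupp.injective h)
    have hinj : Function.Injective fun p : X × List X => p.1 :: p.2 := by
      rintro ⟨a, t⟩ ⟨b, s⟩ h
      simpa using h
    have h2 : (blocks r w).Perm (blocks r w') := (List.map_perm_map_iff hinj).1 h1
    have h3 := List.Perm.eq_of_pairwise (fun p q _ _ h h' => absurd h' h.not_gt)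
      (pairwise_blocks hr (hnd w)) (pairwise_blocks hr (hnd w')) h2
    rw [Subtype.ext_iff, ← concat_blocks r w, h3, concat_blocks]
  have hcomp : (((proj k r).toLinearMap ∘ₗ toModel k e) ∘
      fun w : basisWords X e => blockProd k e (blocks r w))
      = MvPolynomial.basisMonomials (List X) k ∘ m := by
    ext1 w
    simp only [Function.comp_apply, LinearMap.comp_apply, AlgHom.toLinearMap_apply,
      MvPolynomial.coe_basisMonomials]
    exact proj_toModel_blockProd
      (isBlock_of_mem_blocks hr he (hnd w) (mem_basisWords.1 w.2).2)
  rw [hcomp]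
  exact (MvPolynomial.basisMonomials (List X) k).linearIndependent.comp m hm

end

end FreeUnitalGenPoisson

/-! ### The dimension -/

theorem genPComponent_eq (k : Type*) [Field k] (n : ℕ) :
    genPComponent k n = Submodule.span k {f | ∃ w : DiWord (Option (Fin n)),
      w.IsLieProduct none ∧ w.letters = (Finset.univ : Finset (Option (Fin n))).val ∧
        f = FreeUnitalGenPoisson.ofWord k none w} := by
  have h (w : DiWord (Option (Fin n))) : (∀ x, w.count x = 1) ↔
      w.letters = (Finset.univ : Finset (Option (Fin n))).val := by
    simp_rw [← DiWord.count_letters]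
    rw [Multiset.ext]
    refine forall_congr' fun x => ?_
    rw [Multiset.count_eq_one_of_mem Finset.univ.nodup (Finset.mem_univ x)]
  simp only [genPComponent, h, FreeUnitalGenPoisson.ofWord]

theorem mainTheorem2 (k : Type*) [Field k] [CharZero k] (n : ℕ) :
    Module.Finite k (genPComponent k n) ∧
      Module.finrank k (genPComponent k n) = n * n ! := by
  -- Rank `n` puts the unit above every variable.
  let r : Option (Fin n) → ℕ := fun x => x.elim n Fin.val
  have hr : Function.Injective r := by
    rintro (_ | i) (_ | j) h <;> simp only [r, Option.elim] at h
    · rfl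
    · exact absurd h.symm j.2.ne
    · exact absurd h i.2.ne
    · rw [Fin.ext h]
  have he (x : Option (Fin n)) : r x ≤ r none := by
    cases x with
    | none => exact le_rfl
    | some i => exact i.2.le
  rw [genPComponent_eq, FreeUnitalGenPoisson.span_basis_eq hr he]
  refine ⟨Module.Finite.span_of_finite k (Set.finite_range _), ?_⟩
  rw [finrank_span_eq_card (FreeUnitalGenPoisson.linearIndependent_blockProd hr he),
    Fintype.card_coe, FreeUnitalGenPoisson.card_basisWords (n := n) (by simp)]
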